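/- Let $0<s<1$, $n>2s$, $2^*_s=\frac{2n}{n-2s}$, and let $\Omega\subset\mathbb R^n$ be a bounded open set. Let $X_0^s(\Omega)$ be the space of all $v\in L^2(\mathbb R^n)$ with $$\int_{\mathbb R^n\times\mathbb R^n}\frac{|v(x)-v(y)|^2}{|x-y|^{n+2s}}\,dx\,dy<\infty\qquad\text{and}\qquad v=0\ \text{ a.e. in }\mathbb R^n\setminus\Omega .$$ Let $f:\Omega\times\mathbb R\to\mathbb R$ satisfy $|f(x,t)|\le C(1+|t|^p)$ for all $x\in\Omega$ and $t\in\mathbb R$, for some $C>0$ and some $1\le p\le 2^*_s-1$. Let $u$ be a positive weak solution of $$(-\Delta)^s u=f(x,u)\ \text{ in }\Omega,\qquad u=0\ \text{ in }\mathbb R^n\setminus\Omega,$$ that is, $u\in X_0^s(\Omega)$, $u>0$ a.e. in $\Omega$, the function $x\mapsto f(x,u(x))$ is measurable on $\Omega$ (as it is when $f$ is a Carathéodory function), and for every $\varphi\in X_0^s(\Omega)$ $$\int_{\mathbb R^n\times\mathbb R^n}\frac{(u(x)-u(y))(\varphi(x)-\varphi(y))}{|x-y|^{n+2s}}\,dx\,dy=\int_\Omega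 f(x,u(x))\,\varphi(x)\,dx .$$ Then $u\in L^\infty(\Omega)$. -/

import Mathlib

open MeasureTheory

/-- The fractional critical Sobolev exponent `2*_s = 2n / (n - 2s)` (meaningful for `n > 2s`). -/
noncomputable def critExp (n : ℕ) (s : ℝ) : ℝ := 2 * (n : ℝ) / ((n : ℝ) - 2 * s)

/-- The integrand `(u(x) - u(y)) (φ(x) - φ(y)) / |x - y|^(n + 2s)` on `ℝⁿ × ℝⁿ`,
evaluated at `z = (x, y)`. -/
noncomputable def gagliardoKernel {n : ℕ} (s : ℝ) (u φ : EuclideanSpace ℝ (Fin n) → ℝ)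
    (z : EuclideanSpace ℝ (Fin n) × EuclideanSpace ℝ (Fin n)) : ℝ :=
  (u z.1 - u z.2) * (φ z.1 - φ z.2) / ‖z.1 - z.2‖ ^ ((n : ℝ) + 2 * s)

/-- The form
`⟨u, φ⟩ = ∫_{ℝⁿ × ℝⁿ} (u(x) - u(y)) (φ(x) - φ(y)) / |x - y|^(n + 2s) dx dy`. -/
noncomputable def gagliardoForm {n : ℕ} (s : ℝ) (u φ : EuclideanSpace ℝ (Fin n) → ℝ) : ℝ :=
  ∫ z, gagliardoKernel s u φ z ∂((volume : Measure (EuclideanSpace ℝ (Fin n))).prod volume)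

/-- `u ∈ H^s(ℝⁿ)`: `u ∈ L²(ℝⁿ)` and the Gagliardo double integral
`∫_{ℝⁿ × ℝⁿ} |u(x) - u(y)|² / |x - y|^(n + 2s) dx dy` is finite. -/
def MemHs {n : ℕ} (s : ℝ) (u : EuclideanSpace ℝ (Fin n) → ℝ) : Prop :=
  MemLp u 2 volume ∧
    Integrable (gagliardoKernel s u u)
      ((volume : Measure (EuclideanSpace ℝ (Fin n))).prod volume)

/-- `u ∈ X_0^s(Ω)`: `u ∈ H^s(ℝⁿ)` and `u = 0` a.e. in `ℝⁿ \ Ω`. -/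
def MemX0 {n : ℕ} (s : ℝ) (Ω : Set (EuclideanSpace ℝ (Fin n)))
    (u : EuclideanSpace ℝ (Fin n) → ℝ) : Prop :=
  MemHs s u ∧ ∀ᵐ x ∂(volume.restrict Ωᶜ), u x = 0

/-- `u` is a weak solution of `(-Δ)^s u = f(x, u)` in `Ω`, `u = 0` in `ℝⁿ \ Ω`:
`u ∈ X_0^s(Ω)` and, for every `φ ∈ X_0^s(Ω)`, `⟨u, φ⟩ = ∫_Ω f(x, u(x)) φ(x) dx`.
The form on the left always converges absolutely (Cauchy-Schwarz); the integral on the right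
converges absolutely for every `φ ∈ X_0^s(Ω)` as soon as `Ω` is bounded, `n > 2s`,
`f(·, u(·))` is measurable on `Ω` and `f` has at most the critical growth
`|f(x, t)| ≤ C (1 + |t|^(2*_s - 1))` (Sobolev and Hölder), the only case in which this
definition is used. -/
def IsWeakSolution {n : ℕ} (s : ℝ) (Ω : Set (EuclideanSpace ℝ (Fin n)))
    (f : EuclideanSpace ℝ (Fin n) → ℝ → ℝ) (u : EuclideanSpace ℝ (Fin n) → ℝ) : Prop :=
  MemX0 s Ω u ∧
    ∀ φ : EuclideanSpace ℝ (Fin n) → ℝ, MemX0 s Ω φ →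
      gagliardoForm s u φ = ∫ x in Ω, f x (u x) * φ x

/-! The proof is a De Giorgi iteration on U(k) = ∫ (u - k)₊^r, where r = 2*_s. Testing the equation
with (u - k)₊ bounds the energy of that truncation by ∫_Ω |f(x,u)| (u - k)₊. For 1 ≤ h < k, on {u >
k}, the growth condition gives |f(x,u)| ≤ 2C u^(r-1), and u ≤ k/(k-h) · (u - h). With the Sobolev
inequality this yields U(k) ≤ (A (k/(k-h))^(r-1) U(h))^γ with γ = n/(n-2s) > 1
(`exists_levelEnergy_le`).

Such a recursion forces U to vanish at a finite level only once U is small. Critical growth gives no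
smallness by itself, but u ∈ L^r, so U(k) → 0 as k → ∞. The recursion sees h and k only through
k/(k-h), which is invariant under scaling, so the smallness threshold does not depend on the
starting level and a high enough start works (`exists_level_eq_zero`). Vanishing of U bounds u from
above, and positivity bounds it from below.

The Sobolev inequality is proved by hand from a pointwise lower bound for ∫
|v(x)-v(y)|²/|x-y|^(n+2s) dy (`exists_rpow_critExp_le`). -/

/-! ### The abstract iteration. -/

/-- Fast geometric convergence: a truncation energy satisfying a superlinear De Giorgi
recursion and tending to zero vanishes at some finite level. -/
theorem exists_level_eq_zero {g : ℝ → ℝ} {A a γ : ℝ} (hA : 0 < A) (ha : 0 < a) (hγ : 1 < γ)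
    (hg0 : ∀ k, 0 ≤ g k) (hanti : ∀ h k, h ≤ k → g k ≤ g h)
    (hlim : Filter.Tendsto g Filter.atTop (nhds 0))
    (hrec : ∀ h k, 1 ≤ h → h < k → g k ≤ (A * (k / (k - h)) ^ a * g h) ^ γ) :
    ∃ M, g M = 0 := by
  set b : ℝ := 2 ^ a with hb
  have hb1 : 1 < b := Real.one_lt_rpow (by norm_num) ha
  have hb0 : 0 < b := by linarith
  set A' : ℝ := A * 4 ^ a with hA'
  have hA'0 : 0 < A' := by positivity
  -- The decay ratio solving (bδ)^γ = δ: the power γ absorbs the growth b^j of the recursion factor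
  -- at step j.
  set δ : ℝ := b ^ (-(γ / (γ - 1))) with hδ
  have hδ0 : 0 < δ := by positivity
  have hγ1 : 0 < γ - 1 := by linarith
  have hδ1 : δ < 1 := Real.rpow_lt_one_of_one_lt_of_neg hb1 (by
    have : 0 < γ / (γ - 1) := by positivity
    linarith)
  have hbδ : (b * δ) ^ γ = δ := by
    have h1 : b * δ = b ^ (1 + -(γ / (γ - 1))) := by
      rw [Real.rpow_add hb0, Real.rpow_one]
    rw [h1, ← Real.rpow_mul hb0.le, hδ]
    congr 1
    field_simp
    ring
  -- The threshold solving (A'ε)^γ = εδ, so that the bound εδ^j reproduces itself. It involves only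
  -- A, a and γ, never the starting level.
  set ε : ℝ := (δ / A' ^ γ) ^ (1 / (γ - 1)) with hε
  have hε0 : 0 < ε := by positivity
  have hεs : (A' * ε) ^ γ = ε * δ := by
    have h1 : ε ^ γ = ε * (δ / A' ^ γ) := by
      have : ε ^ (γ - 1) = δ / A' ^ γ := by
        rw [hε, ← Real.rpow_mul (by positivity)]
        rw [one_div_mul_cancel hγ1.ne', Real.rpow_one]
      rw [← this]
      nth_rewrite 2 [← Real.rpow_one ε]
      rw [← Real.rpow_add hε0]
      congr 1; ring
    rw [Real.mul_rpow hA'0.le hε0.le, h1]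
    have : A' ^ γ ≠ 0 := by positivity
    field_simp
  obtain ⟨M, hM1, hMε⟩ : ∃ M, 1 ≤ M ∧ g M ≤ ε :=
    ((Filter.eventually_ge_atTop 1).and (hlim.eventually (ge_mem_nhds hε0))).exists
  have hM0 : 0 < M := by linarith
  -- Levels rising from M towards 2M. Consecutive ones satisfy l(j+1)/(l(j+1) - l(j)) ≤ 4·2^j, with
  -- no dependence on M.
  set l : ℕ → ℝ := fun j => M * (2 - (1 / 2) ^ j) with hl
  have hpow : ∀ j : ℕ, (0 : ℝ) < (1 / 2) ^ j ∧ ((1 : ℝ) / 2) ^ j ≤ 1 := fun j =>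
    ⟨by positivity, pow_le_one₀ (by norm_num) (by norm_num)⟩
  have hind : ∀ j, g (l j) ≤ ε * δ ^ j := by
    intro j
    induction j with
    | zero => simpa [hl, show M * (2 - 1) = M by ring] using hMε
    | succ j ih =>
      obtain ⟨hp0, hp1⟩ := hpow j
      have hdiff : l (j + 1) - l j = M * ((1 / 2) ^ j / 2) := by
        simp only [hl, pow_succ]; ring
      have hlj : 1 ≤ l j := by
        simp only [hl]; nlinarith
      have hlt : l j < l (j + 1) := by
        have : 0 < M * (((1 : ℝ) / 2) ^ j / 2) := by positivity
        linarith
      refine (hrec _ _ hlj hlt).trans ?_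
      have hq : l (j + 1) / (l (j + 1) - l j) ≤ 4 * 2 ^ j := by
        rw [hdiff, div_le_iff₀ (by positivity)]
        have h2 : (2 : ℝ) ^ j * (1 / 2) ^ j = 1 := by
          rw [← mul_pow]; norm_num
        have : (4 : ℝ) * 2 ^ j * (M * ((1 / 2) ^ j / 2)) = 2 * M := by
          linear_combination 2 * M * h2
        rw [this]
        simp only [hl]
        nlinarith [(hpow (j + 1)).1]
      have hq0 : 0 ≤ l (j + 1) / (l (j + 1) - l j) := by
        apply div_nonneg <;> linarith
      have hqa : (l (j + 1) / (l (j + 1) - l j)) ^ a ≤ 4 ^ a * b ^ j := by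
        refine (Real.rpow_le_rpow hq0 hq ha.le).trans_eq ?_
        rw [Real.mul_rpow (by norm_num) (by positivity), hb, ← Real.rpow_natCast,
          ← Real.rpow_natCast, ← Real.rpow_mul (by norm_num), ← Real.rpow_mul (by norm_num),
          mul_comm a]
      calc (A * (l (j + 1) / (l (j + 1) - l j)) ^ a * g (l j)) ^ γ
          ≤ (A * (4 ^ a * b ^ j) * (ε * δ ^ j)) ^ γ := by
            have := hg0 (l j)
            apply Real.rpow_le_rpow (by positivity) _ (by linarith)
            gcongr
        _ = ((A' * ε) * (b * δ) ^ j) ^ γ := by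
            congr 1; rw [hA', mul_pow]; ring
        _ = ε * δ ^ (j + 1) := by
            rw [Real.mul_rpow (by positivity) (by positivity), hεs, ← Real.rpow_natCast,
              ← Real.rpow_mul (by positivity), mul_comm (j : ℝ), Real.rpow_mul (by positivity),
              hbδ, Real.rpow_natCast]
            ring
  refine ⟨2 * M, le_antisymm ?_ (hg0 _)⟩
  have ht : Filter.Tendsto (fun j : ℕ => ε * δ ^ j) Filter.atTop (nhds 0) := by
    simpa using (tendsto_pow_atTop_nhds_zero_of_lt_one hδ0.le hδ1).const_mul ε
  refine ge_of_tendsto' ht fun j => (hanti _ _ ?_).trans (hind j)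
  simp only [hl]
  nlinarith [(hpow j).1]

/-! ### The fractional Sobolev inequality. -/

theorem two_lt_critExp {n : ℕ} {s : ℝ} (hs0 : 0 < s) (hn : 2 * s < (n : ℝ)) :
    2 < critExp n s := by
  have : 0 < (n : ℝ) - 2 * s := by linarith
  rw [critExp, lt_div_iff₀ this]
  linarith

theorem gagliardoKernel_self_nonneg {n : ℕ} (s : ℝ) (v : EuclideanSpace ℝ (Fin n) → ℝ)
    (z : EuclideanSpace ℝ (Fin n) × EuclideanSpace ℝ (Fin n)) :
    0 ≤ gagliardoKernel s v v z :=
  div_nonneg (mul_self_nonneg _) (by positivity)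

theorem aemeasurable_gagliardoKernel {n : ℕ} (s : ℝ) {v w : EuclideanSpace ℝ (Fin n) → ℝ}
    (hv : AEMeasurable v volume) (hw : AEMeasurable w volume) :
    AEMeasurable (gagliardoKernel s v w)
      ((volume : Measure (EuclideanSpace ℝ (Fin n))).prod volume) := by
  unfold gagliardoKernel
  refine AEMeasurable.div ((hv.comp_fst.sub hv.comp_snd).mul (hw.comp_fst.sub hw.comp_snd)) ?_
  fun_prop

/-- Pointwise form of the fractional Sobolev inequality. -/
theorem exists_rpow_critExp_le {n : ℕ} {s : ℝ} (hs0 : 0 < s) (hn : 2 * s < (n : ℝ)) :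
    ∃ K : ℝ, 0 < K ∧ ∀ v : EuclideanSpace ℝ (Fin n) → ℝ, (∀ x, 0 ≤ v x) →
      AEMeasurable v volume →
      ∫⁻ x, ENNReal.ofReal (v x ^ critExp n s) ≠ ⊤ →
      ∫⁻ x, ENNReal.ofReal (v x ^ critExp n s) ≠ 0 → ∀ x,
      ENNReal.ofReal (v x ^ critExp n s) ≤ ENNReal.ofReal K *
        (∫⁻ x, ENNReal.ofReal (v x ^ critExp n s)) ^ (2 * s / n) *
        ∫⁻ y, ENNReal.ofReal (gagliardoKernel s v v (x, y)) := by
  have hn0 : (0 : ℝ) < n := by linarith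
  have hns : 0 < (n : ℝ) - 2 * s := by linarith
  have hr2 := two_lt_critExp hs0 hn
  have hrs : critExp n s * (2 * s / n) = critExp n s - 2 := by
    unfold critExp; field_simp; ring
  set r := critExp n s
  set θ : ℝ := 2 * s / n with hθ
  have hθ0 : 0 < θ := by positivity
  have hωtop : volume (Metric.ball (0 : EuclideanSpace ℝ (Fin n)) 1) ≠ ⊤ :=
    measure_ball_lt_top.ne
  set ω : ℝ := (volume (Metric.ball (0 : EuclideanSpace ℝ (Fin n)) 1)).toReal with hω
  have hω0 : 0 < ω := ENNReal.toReal_pos (Metric.measure_ball_pos _ _ one_pos).ne' hωtop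
  -- The factor 2^r comes from halving the level t = v(x), and (2/ω)^(1+θ) from ρ^(n+2s) for the
  -- radius ρ below.
  refine ⟨2 ^ r * (2 / ω) ^ (1 + θ), by positivity, fun v hv0 hvm hI hI0 x => ?_⟩
  rcases (hv0 x).eq_or_lt with hx | ht
  · rw [← hx, Real.zero_rpow (by linarith)]; simp
  set t := v x with htx
  set I := ∫⁻ x, ENNReal.ofReal (v x ^ r) with hIdef
  set J := I.toReal with hJ
  have hIJ : I = ENNReal.ofReal J := (ENNReal.ofReal_toReal hI).symm
  have hJ0 : 0 < J := ENNReal.toReal_pos hI0 hI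
  -- By Chebyshev {v ≥ t/2} has measure at most m, while the ball of radius ρ about x has measure
  -- 2m. So v < t/2 on a part of the ball of measure at least m, where the kernel is at least
  -- (t/2)²/ρ^(n+2s). The resulting bound is a multiple of t² m^(-θ), hence of t^r J^(-θ), because
  -- rθ = r - 2.
  set m : ℝ := (2 / t) ^ r * J with hm
  have hm0 : 0 < m := by positivity
  set ρ : ℝ := (2 * m / ω) ^ (1 / (n : ℝ)) with hρ
  have hρ0 : 0 < ρ := by positivity
  have hρn : ρ ^ n = 2 * m / ω := by
    rw [hρ, ← Real.rpow_natCast, ← Real.rpow_mul (by positivity), one_div_mul_cancel hn0.ne',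
      Real.rpow_one]
  have hρs : ρ ^ ((n : ℝ) + 2 * s) = (2 * m / ω) ^ (1 + θ) := by
    rw [hρ, ← Real.rpow_mul (by positivity)]
    congr 1
    rw [hθ]; field_simp
  have hball : volume (Metric.ball x ρ) = ENNReal.ofReal (2 * m) := by
    rw [Measure.addHaar_ball_of_pos _ _ hρ0, finrank_euclideanSpace_fin, hρn,
      ← ENNReal.ofReal_toReal hωtop, ← hω, ← ENNReal.ofReal_mul (by positivity)]
    congr 1; field_simp
  set T : Set (EuclideanSpace ℝ (Fin n)) :=
    {y | ENNReal.ofReal ((t / 2) ^ r) ≤ ENNReal.ofReal (v y ^ r)} with hT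
  have hT_le : volume T ≤ ENNReal.ofReal m := by
    have h := mul_meas_ge_le_lintegral₀ (μ := (volume : Measure (EuclideanSpace ℝ (Fin n))))
      (f := fun y => ENNReal.ofReal (v y ^ r)) (by fun_prop) (ENNReal.ofReal ((t / 2) ^ r))
    rw [← hIdef, hIJ, mul_comm, ← ENNReal.le_div_iff_mul_le
      (Or.inl (ENNReal.ofReal_pos.2 (by positivity)).ne') (Or.inl ENNReal.ofReal_ne_top),
      ← ENNReal.ofReal_div_of_pos (by positivity)] at h
    refine h.trans_eq ?_
    congr 1
    rw [hm, div_eq_inv_mul, ← Real.inv_rpow (by positivity), inv_div]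
  have hS : ENNReal.ofReal m ≤ volume (Metric.ball x ρ \ T) := by
    refine le_trans ?_ le_measure_sdiff
    rw [hball]
    refine le_trans ?_ (tsub_le_tsub_left hT_le _)
    rw [← ENNReal.ofReal_sub _ hm0.le]
    apply ENNReal.ofReal_le_ofReal; linarith
  have hTm : NullMeasurableSet T volume :=
    nullMeasurableSet_le aemeasurable_const (by fun_prop)
  have hG : ENNReal.ofReal ((t / 2) ^ 2 / ρ ^ ((n : ℝ) + 2 * s) * m) ≤
      ∫⁻ y, ENNReal.ofReal (gagliardoKernel s v v (x, y)) := by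
    rw [ENNReal.ofReal_mul (by positivity)]
    calc _ ≤ ENNReal.ofReal ((t / 2) ^ 2 / ρ ^ ((n : ℝ) + 2 * s)) *
            volume (Metric.ball x ρ \ T) := by gcongr
      _ = ∫⁻ y in Metric.ball x ρ \ T, ENNReal.ofReal ((t / 2) ^ 2 / ρ ^ ((n : ℝ) + 2 * s)) := by
          rw [setLIntegral_const]
      _ ≤ ∫⁻ y in Metric.ball x ρ \ T, ENNReal.ofReal (gagliardoKernel s v v (x, y)) := by
          refine lintegral_mono_ae ?_
          refine (ae_restrict_iff'₀ (measurableSet_ball.nullMeasurableSet.diff hTm)).2 ?_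
          refine Filter.Eventually.of_forall fun y hy => ENNReal.ofReal_le_ofReal ?_
          have hy1 : ‖x - y‖ < ρ := by
            have := hy.1; rwa [Metric.mem_ball, dist_comm, dist_eq_norm] at this
          have hy2 : v y < t / 2 := by
            by_contra hc
            push Not at hc
            exact hy.2 (ENNReal.ofReal_le_ofReal
              (Real.rpow_le_rpow (by positivity) hc (by linarith)))
          have hxy : 0 < ‖x - y‖ := by
            rw [norm_pos_iff, sub_ne_zero]
            rintro rfl
            linarith
          simp only [gagliardoKernel]
          rw [← htx]
          have : (t / 2) ^ 2 ≤ (t - v y) * (t - v y) := by nlinarith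
          gcongr
          exact mul_self_nonneg _
      _ ≤ _ := setLIntegral_le_lintegral _ _
  refine le_trans ?_ (mul_le_mul_right hG _)
  rw [hIJ, ENNReal.ofReal_rpow_of_nonneg hJ0.le hθ0.le, ← ENNReal.ofReal_mul (by positivity),
    ← ENNReal.ofReal_mul (by positivity)]
  apply ENNReal.ofReal_le_ofReal
  rw [hρs]
  apply le_of_eq
  have e1 : (2 * m / ω) ^ (1 + θ) = (2 / ω) ^ (1 + θ) * (m * m ^ θ) := by
    rw [show 2 * m / ω = (2 / ω) * m by ring, Real.mul_rpow (by positivity) hm0.le,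
      Real.rpow_add hm0, Real.rpow_one]
  have e2 : m ^ θ = (t / 2) ^ 2 * ((t / 2) ^ r)⁻¹ * J ^ θ := by
    rw [hm, Real.mul_rpow (by positivity) hJ0.le, ← Real.rpow_mul (by positivity), hrs,
      show 2 / t = (t / 2)⁻¹ by rw [inv_div], Real.inv_rpow (by positivity),
      Real.rpow_sub (by positivity), Real.rpow_two, inv_div, div_eq_mul_inv]
  have e3 : t ^ r = 2 ^ r * (t / 2) ^ r := by
    rw [← Real.mul_rpow (by norm_num) (by positivity)]
    congr 1; ring
  rw [e1, e2, e3]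
  have : (2 / ω) ^ (1 + θ) ≠ 0 := by positivity
  field_simp

/-- Fractional Sobolev inequality for functions already known to lie in `L^{2*_s}`. -/
theorem exists_lintegral_rpow_critExp_le {n : ℕ} {s : ℝ} (hs0 : 0 < s) (hn : 2 * s < (n : ℝ)) :
    ∃ K : ℝ, 0 < K ∧ ∀ v : EuclideanSpace ℝ (Fin n) → ℝ, (∀ x, 0 ≤ v x) →
      AEMeasurable v volume →
      ∫⁻ x, ENNReal.ofReal (v x ^ critExp n s) ≠ ⊤ →
      ∫⁻ x, ENNReal.ofReal (v x ^ critExp n s) ≤ (ENNReal.ofReal K *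
        ∫⁻ z, ENNReal.ofReal (gagliardoKernel s v v z)
          ∂((volume : Measure (EuclideanSpace ℝ (Fin n))).prod volume)) ^ (n / (n - 2 * s)) := by
  obtain ⟨K, hK, H⟩ := exists_rpow_critExp_le hs0 hn
  refine ⟨K, hK, fun v hv0 hvm hI => ?_⟩
  by_cases hI0 : ∫⁻ x, ENNReal.ofReal (v x ^ critExp n s) = 0
  · rw [hI0]; exact zero_le
  have hn0 : (0 : ℝ) < n := by linarith
  have hns : 0 < (n : ℝ) - 2 * s := by linarith
  have h := lintegral_mono (μ := volume) (H v hv0 hvm hI hI0)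
  set I := ∫⁻ x, ENNReal.ofReal (v x ^ critExp n s)
  -- Integrating the pointwise bound gives I ≤ K I^θ E with θ = 2s/n. Dividing by I^θ is where the a
  -- priori finiteness of I is needed.
  have hIθ : I ^ (2 * s / n) ≠ ⊤ := ENNReal.rpow_ne_top_of_nonneg (by positivity) hI
  have hIθ0 : I ^ (2 * s / n) ≠ 0 := by
    rw [Ne, ENNReal.rpow_eq_zero_iff]
    rintro (h | h)
    · exact hI0 h.1
    · exact hI h.1
  rw [lintegral_const_mul' _ _ (ENNReal.mul_ne_top ENNReal.ofReal_ne_top hIθ),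
    ← lintegral_prod _ (aemeasurable_gagliardoKernel s hvm hvm).ennreal_ofReal] at h
  set E := ∫⁻ z, ENNReal.ofReal (gagliardoKernel s v v z)
          ∂((volume : Measure (EuclideanSpace ℝ (Fin n))).prod volume)
  have h1 : I ^ (2 * s / n) * I ^ (((n : ℝ) - 2 * s) / n) = I := by
    rw [← ENNReal.rpow_add _ _ hI0 hI, ← add_div]
    rw [show 2 * s + ((n : ℝ) - 2 * s) = n by ring, div_self hn0.ne', ENNReal.rpow_one]
  have h2 : I ^ (((n : ℝ) - 2 * s) / n) ≤ ENNReal.ofReal K * E := by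
    rw [← ENNReal.mul_le_mul_iff_right hIθ0 hIθ, h1]
    calc I ≤ _ := h
      _ = _ := by ring
  calc I = (I ^ (((n : ℝ) - 2 * s) / n)) ^ ((n : ℝ) / (n - 2 * s)) := by
        rw [← ENNReal.rpow_mul, div_mul_div_comm, mul_comm, div_self (by positivity),
          ENNReal.rpow_one]
    _ ≤ _ := ENNReal.rpow_le_rpow h2 (by positivity)

/-! ### Truncations and their energy. -/

theorem gagliardoKernel_self_comp_le {n : ℕ} (s : ℝ) (u : EuclideanSpace ℝ (Fin n) → ℝ)
    {G : ℝ → ℝ} (hG : ∀ a b, |G a - G b| ≤ |a - b|)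
    (z : EuclideanSpace ℝ (Fin n) × EuclideanSpace ℝ (Fin n)) :
    gagliardoKernel s (fun x => G (u x)) (fun x => G (u x)) z ≤ gagliardoKernel s u u z := by
  unfold gagliardoKernel
  apply div_le_div_of_nonneg_right _ (by positivity)
  exact abs_le_iff_mul_self_le.1 (hG _ _)

theorem abs_posPart_sub_le (k a b : ℝ) : |max (a - k) 0 - max (b - k) 0| ≤ |a - b| := by
  have := abs_max_sub_max_le_abs (a - k) (b - k) 0
  rwa [sub_sub_sub_cancel_right] at this

/-- Functions of `H^s` lie in `L^{2*_s}`. -/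
theorem MemHs.lintegral_rpow_critExp_ne_top {n : ℕ} {s : ℝ} (hs0 : 0 < s)
    (hn : 2 * s < (n : ℝ)) {u : EuclideanSpace ℝ (Fin n) → ℝ} (hu : MemHs s u) :
    ∫⁻ x, ENNReal.ofReal (|u x| ^ critExp n s) ≠ ⊤ := by
  have hns : 0 < (n : ℝ) - 2 * s := by linarith
  have hr2 := two_lt_critExp hs0 hn
  obtain ⟨K, hK, H⟩ := exists_lintegral_rpow_critExp_le hs0 hn
  set r := critExp n s
  have hum : AEMeasurable u volume := hu.1.1.aemeasurable
  set B : ENNReal := (ENNReal.ofReal K * ∫⁻ z, ENNReal.ofReal (gagliardoKernel s u u z)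
    ∂((volume : Measure (EuclideanSpace ℝ (Fin n))).prod volume)) ^ ((n : ℝ) / (n - 2 * s))
    with hB
  have hBtop : B ≠ ⊤ := by
    refine ENNReal.rpow_ne_top_of_nonneg (by positivity)
      (ENNReal.mul_ne_top ENNReal.ofReal_ne_top ?_)
    exact hu.2.lintegral_lt_top.ne
  -- Bounded truncations remove the a priori finiteness: v_m^r ≤ m^(r-2) |u|² is integrable since u
  -- ∈ L². The Sobolev bound B is uniform in m because truncation does not increase the energy, and
  -- Fatou's lemma passes to the limit.
  set v : ℕ → EuclideanSpace ℝ (Fin n) → ℝ := fun m x => min |u x| m with hv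
  have hvm : ∀ m, AEMeasurable (v m) volume := fun m => by fun_prop
  have hL2 : ∫⁻ x, ENNReal.ofReal (|u x| ^ 2) ≠ ⊤ := by
    have := hu.1.integrable_sq.lintegral_lt_top.ne
    simpa [sq_abs] using this
  have hbound : ∀ m, ∫⁻ x, ENNReal.ofReal (v m x ^ r) ≤ B := by
    intro m
    have hv0 : ∀ x, 0 ≤ v m x := fun x => by positivity
    refine (H (v m) hv0 (hvm m) ?_).trans ?_
    · have : ∫⁻ x, ENNReal.ofReal (v m x ^ r) ≤
          ENNReal.ofReal ((m : ℝ) ^ (r - 2)) * ∫⁻ x, ENNReal.ofReal (|u x| ^ 2) := by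
        rw [← lintegral_const_mul' _ _ ENNReal.ofReal_ne_top]
        refine lintegral_mono fun x => ?_
        rw [← ENNReal.ofReal_mul (by positivity)]
        apply ENNReal.ofReal_le_ofReal
        have hsplit : v m x ^ r = v m x ^ (r - 2) * v m x ^ 2 := by
          rw [← Real.rpow_two, ← Real.rpow_add_of_nonneg (hv0 x) (by linarith) (by norm_num),
            sub_add_cancel]
        rw [hsplit]
        exact mul_le_mul (Real.rpow_le_rpow (hv0 x) (min_le_right _ _) (by linarith))
          (pow_le_pow_left₀ (hv0 x) (min_le_left _ _) 2) (sq_nonneg _) (by positivity)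
      exact ne_top_of_le_ne_top (ENNReal.mul_ne_top ENNReal.ofReal_ne_top hL2) this
    · rw [hB]
      gcongr with z
      refine gagliardoKernel_self_comp_le s u (G := fun a => min |a| m) (fun a b => ?_) z
      exact (abs_min_sub_min_le_max _ _ _ _).trans
        (by simpa using abs_abs_sub_abs_le_abs_sub a b)
  have hlim : ∀ x, Filter.liminf (fun m => ENNReal.ofReal (v m x ^ r)) Filter.atTop =
      ENNReal.ofReal (|u x| ^ r) := by
    intro x
    refine (tendsto_const_nhds.congr' ?_).liminf_eq
    filter_upwards [Filter.eventually_ge_atTop ⌈|u x|⌉₊] with m hm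
    have : |u x| ≤ m := Nat.ceil_le.1 hm
    simp only [hv, min_eq_left this]
  refine ne_top_of_le_ne_top hBtop ?_
  calc ∫⁻ x, ENNReal.ofReal (|u x| ^ r)
      = ∫⁻ x, Filter.liminf (fun m => ENNReal.ofReal (v m x ^ r)) Filter.atTop := by
        simp only [hlim]
    _ ≤ Filter.liminf (fun m => ∫⁻ x, ENNReal.ofReal (v m x ^ r)) Filter.atTop :=
        lintegral_liminf_le' fun m => ((hvm m).pow_const r).ennreal_ofReal
    _ ≤ B := Filter.liminf_le_of_frequently_le'
        (Filter.Frequently.of_forall hbound)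

theorem memHs_posPart {n : ℕ} {s : ℝ} {u : EuclideanSpace ℝ (Fin n) → ℝ} (hu : MemHs s u)
    {k : ℝ} (hk : 0 ≤ k) : MemHs s fun x => max (u x - k) 0 := by
  have hum : AEMeasurable u volume := hu.1.1.aemeasurable
  have hm : AEMeasurable (fun x => max (u x - k) 0) volume := by fun_prop
  refine ⟨hu.1.mono hm.aestronglyMeasurable (Filter.Eventually.of_forall fun x => ?_),
    hu.2.mono (aemeasurable_gagliardoKernel s hm hm).aestronglyMeasurable
      (Filter.Eventually.of_forall fun z => ?_)⟩
  · rw [Real.norm_eq_abs, Real.norm_eq_abs, abs_of_nonneg (le_max_right _ _)]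
    exact max_le (by linarith [le_abs_self (u x)]) (abs_nonneg _)
  · rw [Real.norm_of_nonneg (gagliardoKernel_self_nonneg _ _ _),
      Real.norm_of_nonneg (gagliardoKernel_self_nonneg _ _ _)]
    exact gagliardoKernel_self_comp_le s u (G := fun a => max (a - k) 0)
      (abs_posPart_sub_le k) z

theorem memX0_posPart {n : ℕ} {s : ℝ} {Ω : Set (EuclideanSpace ℝ (Fin n))}
    {u : EuclideanSpace ℝ (Fin n) → ℝ} (hu : MemX0 s Ω u) {k : ℝ} (hk : 0 ≤ k) :
    MemX0 s Ω fun x => max (u x - k) 0 := by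
  refine ⟨memHs_posPart hu.1 hk, ?_⟩
  filter_upwards [hu.2] with x hx
  rw [hx]; simpa using hk

/-- The energy of a truncation is controlled by pairing it with the function itself. -/
theorem gagliardoForm_posPart_le {n : ℕ} {s : ℝ} {u : EuclideanSpace ℝ (Fin n) → ℝ}
    (hu : MemHs s u) {k : ℝ} (hk : 0 ≤ k) :
    gagliardoForm s (fun x => max (u x - k) 0) (fun x => max (u x - k) 0) ≤
      gagliardoForm s u fun x => max (u x - k) 0 := by
  have hφ := memHs_posPart hu hk
  have hum : AEMeasurable u volume := hu.1.1.aemeasurable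
  have hm : AEMeasurable (fun x => max (u x - k) 0) volume := by fun_prop
  -- The map t ↦ (t - k)₊ is nondecreasing and 1-Lipschitz. The first inequality compares the
  -- energies; the second dominates the mixed kernel by that of u, which makes it integrable.
  have key : ∀ a b : ℝ, (max (a - k) 0 - max (b - k) 0) * (max (a - k) 0 - max (b - k) 0) ≤
      (a - b) * (max (a - k) 0 - max (b - k) 0) ∧
      (a - b) * (max (a - k) 0 - max (b - k) 0) ≤ (a - b) * (a - b) := by
    intro a b
    rcases max_cases (a - k) 0 with h | h <;> rcases max_cases (b - k) 0 with h' | h' <;>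
      rw [h.1, h'.1] <;> constructor <;> nlinarith
  refine integral_mono hφ.2 (hu.2.mono
    (aemeasurable_gagliardoKernel s hum hm).aestronglyMeasurable
    (Filter.Eventually.of_forall fun z => ?_)) fun z => ?_
  · have h0 : 0 ≤ gagliardoKernel s u (fun x => max (u x - k) 0) z :=
      div_nonneg ((mul_self_nonneg _).trans (key _ _).1) (by positivity)
    rw [Real.norm_of_nonneg h0, Real.norm_of_nonneg (gagliardoKernel_self_nonneg _ _ _)]
    exact div_le_div_of_nonneg_right (key _ _).2 (by positivity)
  · exact div_le_div_of_nonneg_right (key _ _).1 (by positivity)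

theorem lintegral_posPart_rpow_ne_top {n : ℕ} {s : ℝ} (hs0 : 0 < s)
    (hn : 2 * s < (n : ℝ)) {u : EuclideanSpace ℝ (Fin n) → ℝ} (hu : MemHs s u)
    {k : ℝ} (hk : 0 ≤ k) :
    ∫⁻ x, ENNReal.ofReal (max (u x - k) 0 ^ critExp n s) ≠ ⊤ := by
  have hr2 := two_lt_critExp hs0 hn
  refine ne_top_of_le_ne_top (hu.lintegral_rpow_critExp_ne_top hs0 hn) ?_
  refine lintegral_mono fun x => ENNReal.ofReal_le_ofReal ?_
  refine Real.rpow_le_rpow (le_max_right _ _) ?_ (by linarith)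
  exact max_le (by linarith [le_abs_self (u x)]) (abs_nonneg _)

/-! ### De Giorgi iteration for the weak solution. -/

/-- De Giorgi recursion between two truncation levels of a weak solution with critical growth. -/
theorem exists_levelEnergy_le {n : ℕ} {s : ℝ} (hs0 : 0 < s) (hn : 2 * s < (n : ℝ))
    {Ω : Set (EuclideanSpace ℝ (Fin n))} (hΩ : MeasurableSet Ω)
    {f : EuclideanSpace ℝ (Fin n) → ℝ → ℝ} {u : EuclideanSpace ℝ (Fin n) → ℝ} {p C : ℝ}
    (hp2 : p ≤ critExp n s - 1) (hC : 0 < C)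
    (hf : ∀ x ∈ Ω, ∀ t : ℝ, |f x t| ≤ C * (1 + |t| ^ p)) (hu : IsWeakSolution s Ω f u) :
    ∃ A : ℝ, 0 < A ∧ ∀ h k : ℝ, 1 ≤ h → h < k →
      ∫⁻ x, ENNReal.ofReal (max (u x - k) 0 ^ critExp n s) ≤
        (ENNReal.ofReal (A * (k / (k - h)) ^ (critExp n s - 1)) *
          ∫⁻ x, ENNReal.ofReal (max (u x - h) 0 ^ critExp n s)) ^ ((n : ℝ) / (n - 2 * s)) := by
  have hns : 0 < (n : ℝ) - 2 * s := by linarith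
  have hr2 := two_lt_critExp hs0 hn
  obtain ⟨K, hK, H⟩ := exists_lintegral_rpow_critExp_le hs0 hn
  refine ⟨K * (2 * C), by positivity, fun h k hh hhk => ?_⟩
  have hk0 : 0 < k := by linarith
  have hkh : 0 < k - h := by linarith
  have hφ := memX0_posPart hu.1 hk0.le
  refine (H _ (fun x => le_max_right _ _) hφ.1.1.1.aemeasurable
    (lintegral_posPart_rpow_ne_top hs0 hn hu.1.1 hk0.le)).trans ?_
  have hUh := lintegral_posPart_rpow_ne_top hs0 hn hu.1.1 (k := h) (by linarith)
  set r := critExp n s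
  refine ENNReal.rpow_le_rpow ?_ (by positivity)
  rw [mul_assoc K, ENNReal.ofReal_mul hK.le, mul_assoc]
  gcongr
  rw [← ofReal_integral_eq_lintegral_ofReal hφ.1.2
    (Filter.Eventually.of_forall fun z => gagliardoKernel_self_nonneg _ _ _)]
  set D : ℝ := 2 * C * (k / (k - h)) ^ (r - 1) with hD
  have hpt : ∀ x ∈ Ω, ‖f x (u x) * max (u x - k) 0‖ ≤ D * max (u x - h) 0 ^ r := by
    intro x hx
    rcases le_or_gt (u x) k with hux | hux
    · rw [max_eq_right (by linarith)]
      simp only [mul_zero, norm_zero]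
      positivity
    · have h1 : (1 : ℝ) ≤ u x := by linarith
      rw [max_eq_left (by linarith), max_eq_left (by linarith), norm_mul, Real.norm_eq_abs,
        Real.norm_of_nonneg (by linarith)]
      have hfx : |f x (u x)| ≤ 2 * C * u x ^ (r - 1) := by
        have e1 : |u x| ^ p ≤ u x ^ (r - 1) := by
          rw [abs_of_nonneg (by linarith)]
          exact Real.rpow_le_rpow_of_exponent_le h1 hp2
        have e2 : 1 ≤ u x ^ (r - 1) := Real.one_le_rpow h1 (by linarith)
        calc _ ≤ _ := hf x hx (u x)
          _ ≤ C * (u x ^ (r - 1) + u x ^ (r - 1)) := by gcongr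
          _ = _ := by ring
      -- Equivalent to hk ≤ h·u(x), so true exactly because u(x) > k. It trades the full power of u
      -- for a power of u - h, at the cost of the ratio k/(k-h).
      have hux' : u x ≤ k / (k - h) * (u x - h) := by
        rw [div_mul_eq_mul_div, le_div_iff₀ hkh]
        nlinarith
      calc |f x (u x)| * (u x - k)
          ≤ 2 * C * (k / (k - h) * (u x - h)) ^ (r - 1) * (u x - h) := by
            have : u x - k ≤ u x - h := by linarith
            have h3 : u x ^ (r - 1) ≤ (k / (k - h) * (u x - h)) ^ (r - 1) :=
              Real.rpow_le_rpow (by linarith) hux' (by linarith)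
            have h4 : |f x (u x)| ≤ 2 * C * (k / (k - h) * (u x - h)) ^ (r - 1) :=
              hfx.trans (by gcongr)
            exact mul_le_mul h4 this (by linarith) ((abs_nonneg _).trans h4)
        _ = D * (u x - h) ^ r := by
            have h5 : 0 < u x - h := by linarith
            rw [Real.mul_rpow (by positivity) h5.le, hD,
              show (u x - h) ^ r = (u x - h) ^ (r - 1) * (u x - h) by
                rw [← Real.rpow_add_one h5.ne']; congr 1; ring]
            ring
  have hD0 : 0 ≤ D := by positivity
  have hlin : ∫⁻ x in Ω, ENNReal.ofReal ‖f x (u x) * max (u x - k) 0‖ ≤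
      ENNReal.ofReal D * ∫⁻ x, ENNReal.ofReal (max (u x - h) 0 ^ r) := by
    rw [← lintegral_const_mul' _ _ ENNReal.ofReal_ne_top]
    refine (setLIntegral_mono' hΩ fun x hx => ?_).trans (setLIntegral_le_lintegral Ω _)
    rw [← ENNReal.ofReal_mul hD0]
    exact ENNReal.ofReal_le_ofReal (hpt x hx)
  refine le_trans ?_ hlin
  have hlt := ne_top_of_le_ne_top (ENNReal.mul_ne_top ENNReal.ofReal_ne_top hUh) hlin
  apply ENNReal.ofReal_le_of_le_toReal
  calc _ ≤ gagliardoForm s u fun x => max (u x - k) 0 :=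
        gagliardoForm_posPart_le hu.1.1 hk0.le
    _ = ∫ x in Ω, f x (u x) * max (u x - k) 0 := hu.2 _ hφ
    _ ≤ _ := (Real.le_norm_self _).trans (norm_integral_le_lintegral_norm _)

theorem proposition2p2 (n : ℕ) (s : ℝ) (hs0 : 0 < s) (hs1 : s < 1) (hn : 2 * s < (n : ℝ))
    (Ω : Set (EuclideanSpace ℝ (Fin n))) (hΩo : IsOpen Ω) (hΩb : Bornology.IsBounded Ω)
    (f : EuclideanSpace ℝ (Fin n) → ℝ → ℝ) (u : EuclideanSpace ℝ (Fin n) → ℝ)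
    (hfu : AEStronglyMeasurable (fun x => f x (u x)) (volume.restrict Ω))
    (p C : ℝ) (hp1 : 1 ≤ p) (hp2 : p ≤ critExp n s - 1) (hC : 0 < C)
    (hf : ∀ x ∈ Ω, ∀ t : ℝ, |f x t| ≤ C * (1 + |t| ^ p))
    (hu : IsWeakSolution s Ω f u)
    (hpos : ∀ᵐ x ∂(volume.restrict Ω), 0 < u x) :
    MemLp u ⊤ (volume.restrict Ω) := by
  have hns : 0 < (n : ℝ) - 2 * s := by linarith
  have hr2 := two_lt_critExp hs0 hn
  obtain ⟨A, hA, hrec⟩ := exists_levelEnergy_le hs0 hn hΩo.measurableSet hp2 hC hf hu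
  have hfin : ∀ k, 0 ≤ k → ∫⁻ x, ENNReal.ofReal (max (u x - k) 0 ^ critExp n s) ≠ ⊤ :=
    fun k hk => lintegral_posPart_rpow_ne_top hs0 hn hu.1.1 hk
  set r := critExp n s
  set γ : ℝ := (n : ℝ) / (n - 2 * s) with hγ
  have hγ1 : 1 < γ := by rw [hγ, lt_div_iff₀ hns]; linarith
  have hum : AEMeasurable u volume := hu.1.1.1.1.aemeasurable
  set U : ℝ → ENNReal := fun k => ∫⁻ x, ENNReal.ofReal (max (u x - k) 0 ^ r) with hU
  have hUanti : ∀ h k, h ≤ k → U k ≤ U h := fun h k hhk => by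
    refine lintegral_mono fun x => ENNReal.ofReal_le_ofReal ?_
    exact Real.rpow_le_rpow (le_max_right _ _) (by gcongr) (by linarith)
  -- The levels are clamped at `0`, where the energies are known to be finite.
  set g : ℝ → ℝ := fun k => (U (max k 0)).toReal with hg
  -- Dominated convergence with majorant u₊^r, integrable by the Sobolev embedding; at each x the
  -- integrand is zero once k ≥ u(x).
  have hUlim : Filter.Tendsto U Filter.atTop (nhds 0) := by
    have := tendsto_lintegral_filter_of_dominated_convergence' (μ := volume)
      (l := Filter.atTop) (F := fun (k : ℝ) x => ENNReal.ofReal (max (u x - k) 0 ^ r))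
      (f := fun _ => 0) (fun x => ENNReal.ofReal (max (u x - 0) 0 ^ r))
      (Filter.Eventually.of_forall fun k => by fun_prop) ?_ (hfin 0 le_rfl) ?_
    · simpa using this
    · filter_upwards [Filter.eventually_ge_atTop 0] with k hk
      refine Filter.Eventually.of_forall fun x => ENNReal.ofReal_le_ofReal ?_
      exact Real.rpow_le_rpow (le_max_right _ _) (by gcongr) (by linarith)
    · refine Filter.Eventually.of_forall fun x => tendsto_const_nhds.congr' ?_
      filter_upwards [Filter.eventually_ge_atTop (u x)] with k hk
      rw [max_eq_right (by linarith), Real.zero_rpow (by linarith), ENNReal.ofReal_zero]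
  obtain ⟨M, hM⟩ := exists_level_eq_zero (g := g) (A := A) (a := r - 1) (γ := γ) hA
    (by linarith) hγ1 (fun _ => ENNReal.toReal_nonneg)
    (fun h k hhk => ENNReal.toReal_mono (hfin _ (le_max_right _ _))
      (hUanti _ _ (by gcongr)))
    (by
      have h1 : Filter.Tendsto (fun k => (U k).toReal) Filter.atTop (nhds 0) := by
        exact (ENNReal.tendsto_toReal ENNReal.zero_ne_top).comp hUlim
      refine h1.congr' ?_
      filter_upwards [Filter.eventually_ge_atTop 0] with k hk
      simp only [hg, max_eq_left hk])
    (by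
      intro h k hh hhk
      have hk0 : 0 ≤ k / (k - h) := by apply div_nonneg <;> linarith
      simp only [hg, max_eq_left (show 0 ≤ h by linarith), max_eq_left (show 0 ≤ k by linarith)]
      have h1 := ENNReal.toReal_mono (ENNReal.rpow_ne_top_of_nonneg (by positivity)
        (ENNReal.mul_ne_top ENNReal.ofReal_ne_top (hfin h (by linarith)))) (hrec h k hh hhk)
      rwa [← ENNReal.toReal_rpow, ENNReal.toReal_mul,
        ENNReal.toReal_ofReal (by positivity)] at h1)
  -- A zero `toReal` could also come from ⊤; finiteness of the energy excludes that.
  have hUM : U (max M 0) = 0 :=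
    ((ENNReal.toReal_eq_zero_iff _).1 hM).resolve_right (hfin _ (le_max_right _ _))
  have hae := (lintegral_eq_zero_iff' (by fun_prop)).1 hUM
  refine memLp_top_of_bound hu.1.1.1.1.restrict (max M 0) ?_
  filter_upwards [hpos, ae_restrict_of_ae hae] with x hx hx0
  rw [Real.norm_of_nonneg hx.le]
  by_contra hc
  push Not at hc
  have h1 : 0 < max (u x - max M 0) 0 := lt_max_of_lt_left (by linarith)
  have h2 : ENNReal.ofReal (max (u x - max M 0) 0 ^ r) = 0 := hx0
  rw [ENNReal.ofReal_eq_zero] at h2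
  linarith [Real.rpow_pos_of_pos h1 r]
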